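/- An alternating permutation of $[m]=\{1,\dots,m\}$ is a permutation $\pi=\pi_1\pi_2\cdots\pi_m$ of $[m]$ with $\pi_1<\pi_2>\pi_3<\pi_4>\cdots$. A permutation $\pi$ of $[m]$ contains a pattern $\sigma=\sigma_1\cdots\sigma_k$ (a permutation of $[k]$) if there are indices $1\le i_1<\cdots<i_k\le m$ such that, for all $a,b\in[k]$, $\pi_{i_a}<\pi_{i_b}$ if and only if $\sigma_a<\sigma_b$; otherwise $\pi$ avoids $\sigma$. Let $A_m(\sigma)$ denote the set of alternating permutations of $[m]$ that avoid $\sigma$. **Theorem.** For all $n\ge 1$, $|A_{2n}(4312)|=|A_{2n}(1234)|$, and both numbers equal the $n$-th 3-dimensional Catalan number $$\frac{2\,(3n)!}{n!\,(n+1)!\,(n+2)!}.$$ -/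

import Mathlib

open scoped Nat

namespace AltPerm

/-- `π = π₁ π₂ ⋯ π_m` is alternating (up-down): `π₁ < π₂ > π₃ < π₄ > ⋯`.
Positions and values are numbered from `0`, so the ascents are at the even positions. -/
def IsAlternating {m : ℕ} (π : Equiv.Perm (Fin m)) : Prop :=
  ∀ (i : ℕ) (h : i + 1 < m),
    (Even i → π ⟨i, Nat.lt_of_succ_lt h⟩ < π ⟨i + 1, h⟩) ∧
    (Odd i → π ⟨i + 1, h⟩ < π ⟨i, Nat.lt_of_succ_lt h⟩)

/-- `π` contains the pattern `σ`: some subsequence of `π`, at the positions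
`f 0 < f 1 < ⋯ < f (k - 1)`, is order isomorphic to `σ`. -/
def Contains {m k : ℕ} (π : Equiv.Perm (Fin m)) (σ : Equiv.Perm (Fin k)) : Prop :=
  ∃ f : Fin k → Fin m, StrictMono f ∧ ∀ a b : Fin k, π (f a) < π (f b) ↔ σ a < σ b

/-- `A_m(σ)`: the set of alternating permutations of length `m` that avoid `σ`. -/
def avoidingAlternating (m : ℕ) {k : ℕ} (σ : Equiv.Perm (Fin k)) :
    Set (Equiv.Perm (Fin m)) :=
  {π | IsAlternating π ∧ ¬ Contains π σ}

/-- The pattern `4312` (one-line notation, values numbered from `0`). -/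
def pattern4312 : Equiv.Perm (Fin 4) where
  toFun := ![3, 2, 0, 1]
  invFun := ![2, 3, 1, 0]
  left_inv := by decide
  right_inv := by decide

/-- The pattern `1234` (one-line notation, values numbered from `0`). -/
def pattern1234 : Equiv.Perm (Fin 4) where
  toFun := ![0, 1, 2, 3]
  invFun := ![0, 1, 2, 3]
  left_inv := by decide
  right_inv := by decide

end AltPerm

namespace AltPerm

/-! Complementing the values turns up-down permutations avoiding 1234 into down-up permutations
avoiding 4321. Both classes are grown from the empty word by putting two letters in front
(`insertFirst`). Avoidance survives deletion of the first two letters, so each class is a generating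
tree. The admissible insertions depend only on the first letter and on a few thresholds: the least
heights below which 12 and 312, or 21 and 321, occur (`UpDownLabel.insert`, `DownUpLabel.insert`).

For 4321, a node labelled (a, b) has exactly one child for each label (x, y) with 2 ≤ x ≤ a + 1 and
x < y ≤ b + 2. For 4312, some nodes are dead (childless), and the live ones follow a similar rule.

Both rules are solved by iterated partial sums, in the length of the third row, of functions that
obey the recursion for three-row standard Young tableaux: `tabCount` itself for 4321
(`rectCount_succ`), and `markedCount`, with other boundary values, for 4312 (`shiftedCount_succ`).
At the root both give `tabCount n n n`: directly for 4321, and through the closed sum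
`psum_markedCount_self` for 4312. -/

/-! ### Iterated partial sums -/

/-- The sequence of partial sums of `g`. -/
def psum (g : ℕ → ℚ) (l : ℕ) : ℚ := ∑ i ∈ Finset.range (l + 1), g i

lemma psum_zero (g : ℕ → ℚ) : psum g 0 = g 0 := by simp [psum]

lemma psum_succ (g : ℕ → ℚ) (l : ℕ) : psum g (l + 1) = psum g l + g (l + 1) := by
  simp [psum, Finset.sum_range_succ]

lemma psum_add (g h : ℕ → ℚ) : psum (g + h) = psum g + psum h := by
  funext l
  simp [psum, Finset.sum_add_distrib]

lemma psum_const_zero : psum 0 = 0 := by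
  funext l
  simp [psum]

lemma iterate_psum_add (s : ℕ) (g h : ℕ → ℚ) :
    psum^[s] (g + h) = psum^[s] g + psum^[s] h := by
  induction s with
  | zero => rfl
  | succ s ih => simp only [Function.iterate_succ_apply', ih, psum_add]

lemma iterate_psum_zero (s : ℕ) : psum^[s] 0 = 0 := by
  induction s with
  | zero => rfl
  | succ s ih => rw [Function.iterate_succ_apply', ih, psum_const_zero]

lemma iterate_psum_succ_apply (s : ℕ) (g : ℕ → ℚ) (l : ℕ) :
    psum^[s + 1] g (l + 1) = psum^[s + 1] g l + psum^[s] g (l + 1) := by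
  rw [Function.iterate_succ_apply', psum_succ]

/-- If `g (l + 1) = 0` then iterated partial sums at `l + 1` are sums of iterated partial sums
at `l`. -/
lemma iterate_psum_eq_sum {g : ℕ → ℚ} {l : ℕ} (hg : g (l + 1) = 0) (s : ℕ) :
    psum^[s] g (l + 1) = ∑ r ∈ Finset.range s, psum^[r + 1] g l := by
  induction s with
  | zero => simpa using hg
  | succ s ih => rw [iterate_psum_succ_apply, ih, Finset.sum_range_succ, add_comm]

/-! ### Closed forms of tableau type -/

/-- The closed form for the number of standard Young tableaux of shape `(i, j, l)`. -/
def tabCount (i j l : ℕ) : ℚ :=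
  (i + j + l)! * (((i : ℚ) - j + 1) * ((j : ℚ) - l + 1) * ((i : ℚ) - l + 2)) /
    ((i + 2)! * (j + 1)! * l !)

lemma tabCount_eq_zero_left (j l : ℕ) : tabCount j (j + 1) l = 0 := by
  simp [tabCount]

lemma tabCount_eq_zero_left_fun (j : ℕ) : tabCount j (j + 1) = 0 :=
  funext (tabCount_eq_zero_left j)

lemma tabCount_eq_zero_right (i j : ℕ) : tabCount i j (j + 1) = 0 := by
  simp [tabCount]

lemma tabCount_zero (i j : ℕ) :
    tabCount (i + 1) (j + 1) 0 = tabCount i (j + 1) 0 + tabCount (i + 1) j 0 := by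
  unfold tabCount
  rw [show i + 1 + (j + 1) + 0 = (i + j + 1) + 1 by ring, show i + (j + 1) + 0 = i + j + 1 by ring,
    show i + 1 + j + 0 = i + j + 1 by ring]
  simp only [Nat.factorial_succ, Nat.factorial_zero]
  push_cast
  field_simp
  ring

/-- The largest entry of a tableau ends one of its three rows; a term whose shape is not a partition
vanishes through a linear factor of the closed form. -/
lemma tabCount_succ (i j l : ℕ) :
    tabCount (i + 1) (j + 1) (l + 1) =
      tabCount (i + 1) (j + 1) l + (tabCount i (j + 1) (l + 1) + tabCount (i + 1) j (l + 1)) := by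
  unfold tabCount
  rw [show i + 1 + (j + 1) + (l + 1) = (i + j + l + 2) + 1 by ring,
    show i + (j + 1) + (l + 1) = i + j + l + 2 by ring,
    show i + 1 + j + (l + 1) = i + j + l + 2 by ring,
    show i + 1 + (j + 1) + l = i + j + l + 2 by ring]
  rw [Nat.factorial_succ (i + j + l + 2)]
  generalize (i + j + l + 2)! = c
  simp only [Nat.factorial_succ]
  push_cast
  field_simp
  ring

/-- Solving the recursion for the third row leaves a two-term recursion between functions of `l`. -/
lemma tabCount_eq_psum (i j : ℕ) :
    tabCount (i + 1) (j + 1) = psum (tabCount i (j + 1) + tabCount (i + 1) j) := by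
  funext l
  induction l with
  | zero => rw [psum_zero, tabCount_zero, Pi.add_apply]
  | succ l ih => rw [psum_succ, ← ih, tabCount_succ, Pi.add_apply]

/-- The closed form for the number of standard Young tableaux of shape `(i, j, l)` with a marked
entry preceding the third row: `l = 0` stands for an empty third row whose mark is not yet
chosen, `l + 1` for a third row of length `l`. -/
def markedCount (i j : ℕ) : ℕ → ℚ
  | 0 => tabCount i j 0
  | l + 1 => (i + j + l)! * (((i : ℚ) - j + 1) * ((j : ℚ) - l + 1) * ((i : ℚ) - l + 2)) *
      (((i : ℚ) + j + l + 1) * (((i : ℚ) + 1) * (j + 1) + (i + 1) * (l + 1) + (j + 1) * (l + 1)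
        + (j + 1) + 2 * (l + 1)) - (i + 3) * (j + 2) * (l + 1)) /
      ((i + 3)! * (j + 2)! * (l + 1)!)

lemma markedCount_eq_zero_left (j : ℕ) : markedCount j (j + 1) = 0 := by
  funext l
  cases l with
  | zero => simp [markedCount, tabCount]
  | succ l => simp [markedCount]

lemma markedCount_eq_zero_right (i j : ℕ) : markedCount i j (j + 2) = 0 := by
  simp [markedCount]

lemma markedCount_one (i j : ℕ) :
    markedCount (i + 1) (j + 1) 1 = markedCount (i + 1) (j + 1) 0 +
      (markedCount i (j + 1) 1 + markedCount (i + 1) j 1) := by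
  simp only [markedCount, tabCount]
  rw [show i + 1 + (j + 1) + 0 = (i + j + 1) + 1 by ring,
    show i + (j + 1) + 0 = i + j + 1 by ring,
    show i + 1 + j + 0 = i + j + 1 by ring]
  rw [Nat.factorial_succ (i + j + 1)]
  generalize (i + j + 1)! = c
  simp only [Nat.factorial_succ, Nat.factorial_zero]
  push_cast
  field_simp
  ring

lemma markedCount_add_two (i j l : ℕ) :
    markedCount (i + 1) (j + 1) (l + 2) = markedCount (i + 1) (j + 1) (l + 1) +
      (markedCount i (j + 1) (l + 2) + markedCount (i + 1) j (l + 2)) := by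
  simp only [markedCount]
  rw [show i + 1 + (j + 1) + (l + 1) = (i + j + l + 2) + 1 by ring,
    show i + (j + 1) + (l + 1) = i + j + l + 2 by ring,
    show i + 1 + j + (l + 1) = i + j + l + 2 by ring,
    show i + 1 + (j + 1) + l = i + j + l + 2 by ring]
  rw [Nat.factorial_succ (i + j + l + 2)]
  generalize (i + j + l + 2)! = c
  simp only [Nat.factorial_succ]
  push_cast
  field_simp
  ring

lemma markedCount_eq_psum (i j : ℕ) :
    markedCount (i + 1) (j + 1) = psum (markedCount i (j + 1) + markedCount (i + 1) j) := by
  funext l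
  induction l with
  | zero => rw [psum_zero, Pi.add_apply]; exact tabCount_zero i j
  | succ l ih =>
    rw [psum_succ, ← ih, Pi.add_apply]
    cases l with
    | zero => exact markedCount_one i j
    | succ l => exact markedCount_add_two i j l

/-- The quartic is a summation certificate: its increment in `l` is the next summand, so induction
reduces to a polynomial identity. -/
lemma psum_markedCount_self (m l : ℕ) :
    psum (markedCount m m) (l + 1) = (2 * m + 1 + l)! *
      (12 + 2 * (l : ℚ) - l ^ 2 - 2 * l ^ 3 + l ^ 4 + m * (28 - 4 * l - 4 * l ^ 2)
        + m ^ 2 * (23 - 2 * l - 2 * l ^ 2) + 8 * m ^ 3 + m ^ 4) /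
      ((m + 3)! * (m + 2)! * (l + 1)!) := by
  induction l with
  | zero =>
    rw [psum_succ, psum_zero]
    simp only [markedCount, tabCount]
    rw [show 2 * m + 1 + 0 = (m + m + 0) + 1 by ring, Nat.factorial_succ (m + m + 0)]
    generalize (m + m + 0)! = c
    simp only [Nat.factorial_succ, Nat.factorial_zero]
    push_cast
    field_simp
    ring
  | succ l ih =>
    rw [psum_succ, ih]
    simp only [markedCount]
    rw [show 2 * m + 1 + (l + 1) = (m + m + (l + 1)) + 1 by ring,
      show 2 * m + 1 + l = m + m + (l + 1) by ring, Nat.factorial_succ (m + m + (l + 1))]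
    generalize (m + m + (l + 1))! = c
    simp only [Nat.factorial_succ]
    push_cast
    field_simp
    ring

lemma psum_markedCount_self_eq (m : ℕ) :
    psum (markedCount m m) (m + 2) = tabCount (m + 1) (m + 1) (m + 1) := by
  rw [psum_succ, markedCount_eq_zero_right, psum_markedCount_self]
  unfold tabCount
  rw [show m + 1 + (m + 1) + (m + 1) = (2 * m + 1 + m) + 1 + 1 by ring,
    Nat.factorial_succ (2 * m + 1 + m + 1), Nat.factorial_succ (2 * m + 1 + m)]
  generalize (2 * m + 1 + m)! = c
  simp only [Nat.factorial_succ]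
  push_cast
  field_simp
  ring

lemma tabCount_self (n : ℕ) :
    tabCount n n n = 2 * ((3 * n)! : ℚ) / ((n ! : ℚ) * ((n + 1)! : ℚ) * ((n + 2)! : ℚ)) := by
  unfold tabCount
  rw [show n + n + n = 3 * n by ring]
  field_simp
  ring

/-! ### Solutions of the two tree recurrences -/

/-- The number of nodes `k` levels below a node with label `(α + 1, α + 1 + s)` in the tree with
rule `(a, b) ↦ {(x, y) | 2 ≤ x ≤ a + 1, x < y ≤ b + 2}`. -/
def rectCount (k α s : ℕ) : ℚ := psum^[s] (tabCount (k + α) k) k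

lemma rectCount_zero (α s : ℕ) : rectCount 0 α s = 1 := by
  unfold rectCount
  induction s with
  | zero =>
    simp only [Function.iterate_zero, id_eq, tabCount, Nat.factorial_succ, Nat.factorial_zero]
    push_cast
    simp only [zero_add, add_zero]
    field_simp
    ring
  | succ s ih => rw [Function.iterate_succ_apply', psum_zero, ih]

/-- One use of `tabCount_eq_psum` splits the left side in two: shortening the first row trades `α`
for an additional partial sum and gives the terms `u < α` by induction, while shortening the second
row gives `u = α` through `iterate_psum_eq_sum`. At `α = 0` the first part vanishes on the boundary.
-/
lemma rectCount_succ (k α s : ℕ) :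
    rectCount (k + 1) α s =
      ∑ u ∈ Finset.range (α + 1), ∑ r ∈ Finset.range (α + s + 1 - u), rectCount k (u + 1) (r + 1) := by
  have key : ∀ α s, psum^[s + 1] (tabCount (k + (α + 1)) k) (k + 1) =
      ∑ r ∈ Finset.range (s + 1), rectCount k (α + 1) (r + 1) := fun α s =>
    iterate_psum_eq_sum (tabCount_eq_zero_right _ _) _
  have step : ∀ α s, rectCount (k + 1) α s = psum^[s + 1] (tabCount (k + α) (k + 1)) (k + 1) +
      psum^[s + 1] (tabCount (k + (α + 1)) k) (k + 1) := fun α s => by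
    unfold rectCount
    rw [show k + 1 + α = k + α + 1 by ring, tabCount_eq_psum, ← Function.iterate_succ_apply,
      iterate_psum_add, Pi.add_apply]
    rfl
  induction α generalizing s with
  | zero =>
    rw [step, key, add_zero, tabCount_eq_zero_left_fun, iterate_psum_zero]
    simp
  | succ α ih =>
    rw [step, key, Finset.sum_range_succ _ (α + 1),
      show psum^[s + 1] (tabCount (k + (α + 1)) (k + 1)) (k + 1) = rectCount (k + 1) α (s + 1) by
        rw [rectCount, show k + 1 + α = k + (α + 1) by ring], ih]
    congr 1
    · refine Finset.sum_congr rfl fun u _ => ?_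
      rw [show α + (s + 1) + 1 - u = α + 1 + s + 1 - u by omega]
    · rw [show α + 1 + s + 1 - (α + 1) = s + 1 by omega]

/-- The number of nodes `k + 1` levels below a live node with label `(α + 1, α + s)` in the
generating tree of the pattern `4312`. -/
def shiftedCount (k α s : ℕ) : ℚ := psum^[s] (markedCount (k + α) k) (k + 2)

/-- All children count here, dead ones included: for `y = α + t` there are `α + t + 1` choices of `x
≤ y`. -/
lemma shiftedCount_zero (α s : ℕ) :
    shiftedCount 0 α s = ∑ t ∈ Finset.range s, ((α : ℚ) + t + 1) := by
  have h0 : ∀ s, psum^[s] (markedCount (0 + α) 0) 0 = 1 := fun s => by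
    induction s with
    | zero =>
      simp only [Function.iterate_zero, id_eq, markedCount, tabCount, Nat.factorial_succ,
        Nat.factorial_zero]
      push_cast
      simp only [zero_add, add_zero]
      field_simp
      ring
    | succ s ih => rw [Function.iterate_succ_apply', psum_zero, ih]
  have h1 : ∀ s, psum^[s] (markedCount (0 + α) 0) 1 = α + s := fun s => by
    induction s with
    | zero =>
      simp only [Function.iterate_zero, id_eq, markedCount, Nat.factorial_succ,
        Nat.factorial_zero]
      push_cast
      simp only [zero_add, add_zero]
      field_simp
      ring
    | succ s ih =>
      rw [iterate_psum_succ_apply, h0, ih]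
      push_cast
      ring
  unfold shiftedCount
  rw [show (0 + 2 : ℕ) = 1 + 1 from rfl,
    iterate_psum_eq_sum (l := 1) (markedCount_eq_zero_right _ 0)]
  refine Finset.sum_congr rfl fun t _ => ?_
  rw [h1]
  push_cast
  ring

/-- The vanishing of `markedCount` at the evaluation point yields the sum over `j`; each summand is
then unrolled in `α` as in `rectCount_succ`. -/
lemma shiftedCount_succ (k α s : ℕ) :
    shiftedCount (k + 1) α s = ∑ j ∈ Finset.range s, ∑ u ∈ Finset.range (α + 1),
      shiftedCount k (u + 1) (α + 2 + j - u) := by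
  have step : ∀ α j, psum^[j + 1] (markedCount (k + 1 + α) (k + 1)) (k + 2) =
      ∑ u ∈ Finset.range (α + 1), shiftedCount k (u + 1) (α + 2 + j - u) := fun α => by
    induction α with
    | zero =>
      intro j
      rw [add_zero, markedCount_eq_psum, markedCount_eq_zero_left, zero_add,
        ← Function.iterate_succ_apply]
      rw [zero_add, Finset.sum_range_one, show 0 + 2 + j - 0 = j + 2 by omega]
      rfl
    | succ α ih =>
      intro j
      rw [show k + 1 + (α + 1) = (k + 1 + α) + 1 by ring, markedCount_eq_psum,
        ← Function.iterate_succ_apply, iterate_psum_add, Pi.add_apply, ih,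
        Finset.sum_range_succ _ (α + 1)]
      congr 1
      · refine Finset.sum_congr rfl fun u _ => ?_
        rw [show α + 2 + (j + 1) - u = α + 1 + 2 + j - u by omega]
      · rw [show α + 1 + 2 + j - (α + 1) = j + 2 by omega, shiftedCount,
          show k + (α + 1 + 1) = k + 1 + α + 1 by ring]
  unfold shiftedCount
  rw [iterate_psum_eq_sum (l := k + 2) (markedCount_eq_zero_right _ (k + 1))]
  exact Finset.sum_congr rfl fun j _ => step α j

/-! ### Words of permutations and insertion of a first letter -/

/-- Make room for the value `x`. -/
def bump (x v : ℕ) : ℕ := if v < x then v else v + 1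

/-- The threshold that corresponds to `t` before room is made for the value `x`. -/
def unbump (x t : ℕ) : ℕ := if t ≤ x then t else t - 1

/-- Put the letter `x` in front of the word `L`, and make room for it. -/
def insertFirst (x : ℕ) (L : List ℕ) : List ℕ := x :: L.map (bump x)

lemma bump_lt_iff (x v t : ℕ) : bump x v < t ↔ v < unbump x t := by
  unfold bump unbump; split_ifs <;> omega

lemma bump_lt_bump (x v w : ℕ) : bump x v < bump x w ↔ v < w := by
  unfold bump; split_ifs <;> omega

lemma lt_bump_iff (x v : ℕ) : x < bump x v ↔ x ≤ v := by
  unfold bump; split_ifs <;> omega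

lemma bump_injective (x : ℕ) : Function.Injective (bump x) := fun v w h => by
  unfold bump at h; split_ifs at h <;> omega

lemma unbump_self (x : ℕ) : unbump x x = x := by simp [unbump]

lemma unbump_bump (x v : ℕ) : unbump x (bump x v) = v := by
  unfold bump unbump; split_ifs <;> omega

/-- The words of the permutations of `{0, …, m - 1}`. -/
def permWords : ℕ → Finset (List ℕ)
  | 0 => {[]}
  | m + 1 => (Finset.range (m + 1) ×ˢ permWords m).image fun p => insertFirst p.1 p.2

lemma insertFirst_injective {x y : ℕ} {L M : List ℕ} (h : insertFirst x L = insertFirst y M) :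
    x = y ∧ L = M := by
  obtain ⟨rfl, h'⟩ := List.cons.inj h
  exact ⟨rfl, (List.map_injective_iff.2 (bump_injective x)) h'⟩

lemma sum_permWords_succ (m : ℕ) (g : List ℕ → ℚ) :
    ∑ L ∈ permWords (m + 1), g L =
      ∑ L ∈ permWords m, ∑ x ∈ Finset.range (m + 1), g (insertFirst x L) := by
  rw [permWords, Finset.sum_image, Finset.sum_product_right]
  rintro ⟨x, L⟩ _ ⟨y, M⟩ _ h
  obtain ⟨rfl, rfl⟩ := insertFirst_injective h
  rfl

lemma mem_permWords_iff {m : ℕ} {L : List ℕ} :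
    L ∈ permWords m ↔ L.Nodup ∧ ∀ v, v ∈ L ↔ v < m := by
  induction m generalizing L with
  | zero =>
    simp only [permWords, Finset.mem_singleton, Nat.not_lt_zero, iff_false]
    exact ⟨fun h => by simp [h], fun h => List.eq_nil_iff_forall_not_mem.2 h.2⟩
  | succ m ih =>
    simp only [permWords, Finset.mem_image, Finset.mem_product, Finset.mem_range, Prod.exists]
    constructor
    · rintro ⟨x, M, ⟨hx, hM⟩, rfl⟩
      obtain ⟨hn, hm⟩ := ih.1 hM
      refine ⟨List.nodup_cons.2 ⟨?_, hn.map (bump_injective x)⟩, fun v => ?_⟩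
      · rw [List.mem_map]
        rintro ⟨v, -, hv⟩
        unfold bump at hv; split_ifs at hv <;> omega
      · simp only [insertFirst, List.mem_cons, List.mem_map, hm]
        constructor
        · rintro (rfl | ⟨w, hw, rfl⟩)
          · exact hx
          · unfold bump; split_ifs <;> omega
        · intro hv
          rcases lt_trichotomy v x with h | h | h
          · exact Or.inr ⟨v, by omega, by simp [bump, h]⟩
          · exact Or.inl h
          · exact Or.inr ⟨v - 1, by omega, by unfold bump; split_ifs <;> omega⟩
    · rintro ⟨hn, hm⟩
      cases L with
      | nil => exact absurd ((hm 0).2 (Nat.succ_pos m)) (by simp)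
      | cons x M =>
        obtain ⟨hx, hM⟩ := List.nodup_cons.1 hn
        have hb : ∀ v ∈ M, bump x (unbump x v) = v := fun v hv => by
          have : v ≠ x := fun h => hx (h ▸ hv)
          unfold bump unbump; split_ifs <;> omega
        have hb' : (M.map (unbump x)).map (bump x) = M := by
          rw [List.map_map]
          exact (List.map_congr_left hb).trans (List.map_id M)
        have hxm : x < m + 1 := (hm x).1 (by simp)
        refine ⟨x, M.map (unbump x), ⟨hxm, ih.2 ⟨.of_map (bump x) (by rwa [hb']), fun v => ?_⟩⟩,
          by rw [insertFirst, hb']⟩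
        have hv : bump x v ∈ M ↔ bump x v < m + 1 := by
          rw [← hm, List.mem_cons, or_iff_right]
          unfold bump; split_ifs <;> omega
        have hv' : v < m ↔ bump x v < m + 1 := by unfold bump; split_ifs <;> omega
        rw [hv', ← hv, List.mem_map]
        constructor
        · rintro ⟨w, hw, rfl⟩
          rwa [hb w hw]
        · exact fun h => ⟨_, h, unbump_bump x v⟩

lemma length_of_mem_permWords {m : ℕ} {L : List ℕ} (h : L ∈ permWords m) : L.length = m := by
  induction m generalizing L with
  | zero => simp_all [permWords]
  | succ m ih =>
    simp only [permWords, Finset.mem_image, Finset.mem_product, Prod.exists] at h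
    obtain ⟨x, M, ⟨-, hM⟩, rfl⟩ := h
    simp [insertFirst, ih hM]

/-! ### Pattern occurrences below a threshold -/

/-- `L` has an entry below `t` that is followed by an occurrence of `Q` below this entry. -/
def topThen (Q : List ℕ → ℕ → Prop) : List ℕ → ℕ → Prop
  | [], _ => False
  | x :: L, t => topThen Q L t ∨ (x < t ∧ Q L x)

/-- `L` has an entry that is followed by an occurrence of `Q` below this entry. -/
def hasTopThen (Q : List ℕ → ℕ → Prop) : List ℕ → Prop
  | [] => False
  | x :: L => hasTopThen Q L ∨ Q L x

/-- `L` has an entry below `t`. -/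
def hasBelow (L : List ℕ) (t : ℕ) : Prop := ∃ v ∈ L, v < t

/-- `L` has an ascent pattern `12` with both entries below `t`. -/
def asc : List ℕ → ℕ → Prop
  | [], _ => False
  | x :: L, t => asc L t ∨ ∃ v ∈ L, x < v ∧ v < t

/-- `Q` is compatible with making room for a value. -/
def BumpInvariant (Q : List ℕ → ℕ → Prop) : Prop :=
  ∀ x L t, Q (L.map (bump x)) t ↔ Q L (unbump x t)

lemma bumpInvariant_hasBelow : BumpInvariant hasBelow := fun x L t => by
  simp [hasBelow, bump_lt_iff]

lemma bumpInvariant_asc : BumpInvariant asc := fun x L t => by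
  induction L with
  | nil => simp [asc]
  | cons v L ih => simp [asc, ih, bump_lt_iff, unbump_bump]

lemma BumpInvariant.topThen {Q : List ℕ → ℕ → Prop} (hQ : BumpInvariant Q) :
    BumpInvariant (topThen Q) := fun x L t => by
  induction L with
  | nil => simp [AltPerm.topThen]
  | cons v L ih => simp [AltPerm.topThen, ih, hQ x L, bump_lt_iff, unbump_bump]

lemma topThen_insertFirst {Q : List ℕ → ℕ → Prop} (hQ : BumpInvariant Q) (x : ℕ) (L : List ℕ)
    (t : ℕ) : topThen Q (insertFirst x L) t ↔ topThen Q L (unbump x t) ∨ (x < t ∧ Q L x) := by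
  rw [insertFirst, topThen, hQ.topThen, hQ x L x, unbump_self]

lemma hasTopThen_map_bump {Q : List ℕ → ℕ → Prop} (hQ : BumpInvariant Q) (x : ℕ) (L : List ℕ) :
    hasTopThen Q (L.map (bump x)) ↔ hasTopThen Q L := by
  induction L with
  | nil => simp [hasTopThen]
  | cons v L ih => simp [hasTopThen, ih, hQ x L, unbump_bump]

lemma hasTopThen_insertFirst {Q : List ℕ → ℕ → Prop} (hQ : BumpInvariant Q) (x : ℕ)
    (L : List ℕ) : hasTopThen Q (insertFirst x L) ↔ hasTopThen Q L ∨ Q L x := by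
  rw [insertFirst, hasTopThen, hasTopThen_map_bump hQ, hQ x L x, unbump_self]

/-- Every larger value follows the new first letter `x`, so the cheapest ascent from `x` ends at `x
+ 1`. -/
lemma asc_insertFirst {m : ℕ} {L : List ℕ} (hL : ∀ v, v ∈ L ↔ v < m) (x : ℕ) {t : ℕ}
    (ht : t ≤ m + 1) :
    asc (insertFirst x L) t ↔ asc L (unbump x t) ∨ x + 1 < t := by
  rw [insertFirst, asc, bumpInvariant_asc x L]
  refine or_congr_right ?_
  simp only [List.mem_map, exists_exists_and_eq_and, lt_bump_iff, bump_lt_iff, hL]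
  constructor
  · rintro ⟨v, hv, h1, h2⟩
    unfold unbump at h2; split_ifs at h2 <;> omega
  · intro h
    exact ⟨x, by omega, le_rfl, by unfold unbump; split_ifs <;> omega⟩

lemma hasBelow_iff {m : ℕ} {L : List ℕ} (hL : ∀ v, v ∈ L ↔ v < m) {t : ℕ} (ht : t ≤ m) :
    hasBelow L t ↔ 0 < t := by
  simp only [hasBelow, hL]
  exact ⟨fun ⟨v, _, hv⟩ => by omega, fun h => ⟨0, by omega, h⟩⟩

/-! ### Zigzag words -/

/-- `L` is alternating: `x₀` and `x₁`, `x₂` and `x₁`, `x₂` and `x₃`, … are in the relation `r`. -/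
def zigzag (r : ℕ → ℕ → Prop) : List ℕ → Prop
  | [] => True
  | [_] => True
  | x :: y :: L => r x y ∧ (∀ h ∈ L.head?, r h y) ∧ zigzag r L

lemma zigzag_map_bump {r : ℕ → ℕ → Prop} (hr : ∀ x v w, r (bump x v) (bump x w) ↔ r v w) (x : ℕ) :
    ∀ L, zigzag r (L.map (bump x)) ↔ zigzag r L
  | [] => by simp [zigzag]
  | [_] => by simp [zigzag]
  | v :: w :: L => by simp [zigzag, hr, zigzag_map_bump hr x L]

lemma zigzag_insertFirst {r : ℕ → ℕ → Prop} (hr : ∀ x v w, r (bump x v) (bump x w) ↔ r v w)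
    (x y : ℕ) (L : List ℕ) : zigzag r (insertFirst x (insertFirst y L)) ↔
      r x (bump x y) ∧ (∀ h ∈ L.head?, r (bump y h) y) ∧ zigzag r L := by
  rw [insertFirst, insertFirst, List.map_cons, zigzag, zigzag_map_bump hr, zigzag_map_bump hr]
  simp [hr]

lemma zigzag_iff_getElem {r : ℕ → ℕ → Prop} : ∀ L : List ℕ, zigzag r L ↔
    ∀ (i : ℕ) (h : i + 1 < L.length), (Even i → r L[i] L[i + 1]) ∧ (Odd i → r L[i + 1] L[i])
  | [] => by simp [zigzag]
  | [_] => by simp [zigzag]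
  | x :: y :: L => by
    rw [zigzag, zigzag_iff_getElem L]
    constructor
    · rintro ⟨h1, h2, h3⟩ i hi
      match i with
      | 0 => simpa using h1
      | 1 =>
        simp only [List.length_cons] at hi
        have : 0 < L.length := by omega
        simpa using h2 L[0] (by simp [List.head?_eq_getElem?, this])
      | i + 2 =>
        simp only [List.length_cons] at hi
        simpa [Nat.even_add, Nat.odd_add] using h3 i (by omega)
    · intro h
      refine ⟨by simpa using h 0 (by simp), fun v hv => ?_, fun i hi => ?_⟩
      · cases L with
        | nil => simp at hv
        | cons w L =>
          obtain rfl : w = v := by simpa using hv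
          exact (h 1 (by simp)).2 odd_one
      · have h' := h (i + 2) (by simp only [List.length_cons]; omega)
        exact ⟨fun hi => h'.1 (hi.add even_two), fun hi => h'.2 (hi.add_even even_two)⟩

/-! ### Counting descendants -/

open Classical in
/-- The number of words that satisfy `V` and arise from `L` by inserting `k` pairs of letters. -/
noncomputable def descendants (V : List ℕ → Prop) : ℕ → List ℕ → ℚ
  | 0, _ => 1
  | k + 1, L => ∑ y ∈ Finset.range (L.length + 1), ∑ x ∈ Finset.range (L.length + 2),
      if V (insertFirst x (insertFirst y L)) then
        descendants V k (insertFirst x (insertFirst y L)) else 0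

open Classical in
lemma sum_descendants (V : List ℕ → Prop)
    (hV : ∀ x y L, V (insertFirst x (insertFirst y L)) → V L) (m k : ℕ) :
    ∑ L ∈ permWords m, (if V L then descendants V (k + 1) L else 0) =
      ∑ L ∈ permWords (m + 2), if V L then descendants V k L else 0 := by
  rw [sum_permWords_succ, sum_permWords_succ]
  refine Finset.sum_congr rfl fun L hL => ?_
  rw [descendants, length_of_mem_permWords hL]
  split_ifs with h
  · rfl
  · refine (Finset.sum_eq_zero fun y _ => Finset.sum_eq_zero fun x _ => ?_).symm
    rw [if_neg fun h' => h (hV x y L h')]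

open Classical in
-- By `hV`, stripping leading pairs never leaves `V`, so each word counted is reached from the empty
-- word by a unique chain inside `V`.
lemma card_filter_permWords (V : List ℕ → Prop) (h0 : V [])
    (hV : ∀ x y L, V (insertFirst x (insertFirst y L)) → V L) (n : ℕ) :
    (((permWords (2 * n)).filter V).card : ℚ) = descendants V n [] := by
  have h : ∀ k m, ∑ L ∈ permWords m, (if V L then descendants V k L else 0) =
      ∑ L ∈ permWords (m + 2 * k), if V L then 1 else 0 := fun k => by
    induction k with
    | zero => intro m; rfl
    | succ k ih =>
      intro m
      rw [sum_descendants V hV, ih, show m + 2 + 2 * k = m + 2 * (k + 1) by ring]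
  have h' := h n 0
  rw [zero_add, permWords, Finset.sum_singleton, if_pos h0] at h'
  rw [h', Finset.card_filter]
  push_cast
  rfl

/-! ### The generating trees -/

lemma insertFirst_mem_permWords {m x : ℕ} {L : List ℕ} (hL : L ∈ permWords m) (hx : x ≤ m) :
    insertFirst x L ∈ permWords (m + 1) :=
  Finset.mem_image.2 ⟨(_, _), by simp [Finset.mem_product, hL]; omega, rfl⟩

/-- The words of up-down permutations that avoid `4312`. -/
def UpDownAvoid (L : List ℕ) : Prop := zigzag (· < ·) L ∧ ¬ hasTopThen (topThen asc) L

/-- The words of down-up permutations that avoid `4321`. -/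
def DownUpAvoid (L : List ℕ) : Prop :=
  zigzag (· > ·) L ∧ ¬ hasTopThen (topThen (topThen hasBelow)) L

lemma upDownAvoid_insertFirst (x y : ℕ) (L : List ℕ) :
    UpDownAvoid (insertFirst x (insertFirst y L)) ↔
      UpDownAvoid L ∧ x ≤ y ∧ (∀ h ∈ L.head?, h < y) ∧ ¬ topThen asc L y ∧
        ¬ topThen asc (insertFirst y L) x := by
  unfold UpDownAvoid
  rw [zigzag_insertFirst bump_lt_bump, hasTopThen_insertFirst bumpInvariant_asc.topThen,
    hasTopThen_insertFirst bumpInvariant_asc.topThen, lt_bump_iff]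
  simp only [bump_lt_iff, unbump_self]
  tauto

lemma downUpAvoid_insertFirst (x y : ℕ) (L : List ℕ) :
    DownUpAvoid (insertFirst x (insertFirst y L)) ↔
      DownUpAvoid L ∧ y < x ∧ (∀ h ∈ L.head?, y ≤ h) ∧ ¬ topThen (topThen hasBelow) L y ∧
        ¬ topThen (topThen hasBelow) (insertFirst y L) x := by
  unfold DownUpAvoid
  rw [zigzag_insertFirst fun x v w => bump_lt_bump x w v,
    hasTopThen_insertFirst bumpInvariant_hasBelow.topThen.topThen,
    hasTopThen_insertFirst bumpInvariant_hasBelow.topThen.topThen]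
  have h : x > bump x y ↔ y < x := by rw [gt_iff_lt, bump_lt_iff, unbump_self]
  simp only [gt_iff_lt, lt_bump_iff] at h ⊢
  rw [h]
  tauto

/-! ### Labels and their change under insertion -/

/-- `L` is the word of an up-down permutation of `{0, …, m - 1}` that avoids `4312`. An entry at
height `y` may be inserted in front of `L` without creating an ascent if and only if `f ≤ y`;
the patterns `12` and `312` occur below `t` if and only if `d ≤ t` and `M ≤ t`, respectively. -/
structure UpDownLabel (m : ℕ) (L : List ℕ) (f d M : ℕ) : Prop where
  mem : L ∈ permWords m
  avoid : UpDownAvoid L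
  head : ∀ y ≤ m, (∀ h ∈ L.head?, h < y) ↔ f ≤ y
  asc_iff : ∀ t ≤ m, asc L t ↔ d ≤ t
  top_iff : ∀ t ≤ m, topThen asc L t ↔ M ≤ t

lemma UpDownLabel.avoid_iff {m f d M x y : ℕ} {L : List ℕ} (h : UpDownLabel m L f d M)
    (hy : y ≤ m) (hx : x ≤ m + 1) :
    UpDownAvoid (insertFirst x (insertFirst y L)) ↔ x ≤ y ∧ f ≤ y ∧ y < M := by
  rw [upDownAvoid_insertFirst, h.head y hy, h.top_iff y hy, topThen_insertFirst bumpInvariant_asc]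
  have h1 := h.avoid
  constructor
  · rintro ⟨_, h2, h3, h4, _⟩
    omega
  · rintro ⟨h2, h3, h4⟩
    refine ⟨h1, h2, h3, by omega, ?_⟩
    -- As `x ≤ y`, the letter `y` is not below `x`; old occurrences of 312 below `x` are excluded by
    -- `x ≤ y < M`.
    rw [show unbump y x = x by simp [unbump, h2], h.top_iff x (by omega)]
    omega

/-- If `d ≤ x`, the first letter tops an ascent and makes a 312 below `x + 1`. If `x < d ≤ y`, the
second letter does, having moved up to `y + 1`. Otherwise only old occurrences of 312 remain, lifted
by both letters. -/
lemma UpDownLabel.insert {m f d M x y : ℕ} {L : List ℕ} (h : UpDownLabel m L f d M)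
    (hy : y ≤ m) (hxy : x ≤ y) (hf : f ≤ y) (hM : y < M) :
    UpDownLabel (m + 2) (insertFirst x (insertFirst y L)) (x + 1)
      (if x < d then x + 2 else d)
      (if x < d then (if d ≤ y then y + 2 else M + 2) else x + 1) where
  mem := insertFirst_mem_permWords (insertFirst_mem_permWords h.mem hy) (by omega)
  avoid := (h.avoid_iff hy (by omega)).2 ⟨hxy, hf, hM⟩
  head t _ := by simp [insertFirst]
  asc_iff t ht := by
    have hL := (mem_permWords_iff.1 h.mem).2
    have hL' : insertFirst y L ∈ permWords (m + 1) := insertFirst_mem_permWords h.mem hy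
    rw [asc_insertFirst (mem_permWords_iff.1 hL').2 x (by omega),
      asc_insertFirst hL y (by unfold unbump; split_ifs <;> omega),
      h.asc_iff _ (by unfold unbump; split_ifs <;> omega)]
    unfold unbump
    split_ifs <;> omega
  top_iff t ht := by
    have hL := (mem_permWords_iff.1 h.mem).2
    rw [topThen_insertFirst bumpInvariant_asc, topThen_insertFirst bumpInvariant_asc,
      asc_insertFirst hL y (by omega), h.asc_iff _ hy,
      h.asc_iff _ (by unfold unbump; split_ifs; omega),
      h.top_iff _ (by unfold unbump; split_ifs <;> omega)]
    unfold unbump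
    split_ifs <;> omega

/-- `L` is the word of a down-up permutation of `{0, …, m - 1}` that avoids `4321`. The patterns
`21` and `321` occur below `t` if and only if `a ≤ t` and `b ≤ t`, respectively. -/
structure DownUpLabel (m : ℕ) (L : List ℕ) (a b : ℕ) : Prop where
  mem : L ∈ permWords m
  avoid : DownUpAvoid L
  head : ∀ h ∈ L.head?, a ≤ h + 1
  desc_iff : ∀ t ≤ m, topThen hasBelow L t ↔ a ≤ t
  top_iff : ∀ t ≤ m, topThen (topThen hasBelow) L t ↔ b ≤ t

lemma DownUpLabel.avoid_iff {m a b x y : ℕ} {L : List ℕ} (h : DownUpLabel m L a b)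
    (hab : a ≤ b) (hy : y ≤ m) (hx : x ≤ m + 1) :
    DownUpAvoid (insertFirst x (insertFirst y L)) ↔ y < a ∧ y < x ∧ x ≤ b := by
  have h1 := h.avoid
  rw [downUpAvoid_insertFirst, h.top_iff y hy, topThen_insertFirst bumpInvariant_hasBelow.topThen,
    h.desc_iff y hy, h.top_iff _ (by unfold unbump; split_ifs <;> omega)]
  unfold unbump
  constructor
  · rintro ⟨_, h2, _, h4, h5⟩
    split_ifs at h5 <;> omega
  · rintro ⟨h2, h3, h4⟩
    -- The zigzag condition at the old head is automatic: `y < a ≤ v + 1`.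
    refine ⟨h1, h3, fun v hv => ?_, by omega, by split_ifs <;> omega⟩
    have := h.head v hv
    omega

/-- If `y > 0`, a 0 follows, so `y` tops a 21 and `x` a 321. If `y = 0`, then `x` tops a 21 with it,
and tops a 321 exactly when an old 21, lifted by one, lies below `x`, that is when `a < x`. -/
lemma DownUpLabel.insert {m a b x y : ℕ} {L : List ℕ} (h : DownUpLabel m L a b)
    (hab : a ≤ b) (hy : y ≤ m) (hya : y < a) (hyx : y < x) (hxb : x ≤ b) (hx : x ≤ m + 1) :
    DownUpLabel (m + 2) (insertFirst x (insertFirst y L))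
      (if 0 < y then y + 1 else min (x + 1) (a + 1))
      (if 0 < y then x + 1 else if x ≤ a then b + 2 else x + 1) := by
  have hL := (mem_permWords_iff.1 h.mem).2
  have hL' : insertFirst y L ∈ permWords (m + 1) := insertFirst_mem_permWords h.mem hy
  refine ⟨insertFirst_mem_permWords hL' hx, (h.avoid_iff hab hy hx).2 ⟨hya, hyx, hxb⟩, ?_, ?_, ?_⟩
  · simp only [insertFirst, List.head?_cons, Option.mem_some_iff, forall_eq']
    split_ifs <;> omega
  · intro t ht
    rw [topThen_insertFirst bumpInvariant_hasBelow, topThen_insertFirst bumpInvariant_hasBelow,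
      hasBelow_iff hL hy, hasBelow_iff (mem_permWords_iff.1 hL').2 hx,
      h.desc_iff _ (by unfold unbump; split_ifs <;> omega)]
    unfold unbump
    split_ifs <;> omega
  · intro t ht
    rw [topThen_insertFirst bumpInvariant_hasBelow.topThen,
      topThen_insertFirst bumpInvariant_hasBelow.topThen,
      topThen_insertFirst bumpInvariant_hasBelow,
      hasBelow_iff hL hy, h.desc_iff y hy,
      h.desc_iff _ (by unfold unbump; split_ifs <;> omega),
      h.top_iff _ (by unfold unbump; split_ifs <;> omega)]
    unfold unbump
    split_ifs <;> omega

/-! ### Counting the descendants of labelled words -/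

lemma sum_range_eq_of_support {g : ℕ → ℚ} {n α s : ℕ} (hn : α + s ≤ n)
    (h : ∀ i < n, i < α ∨ α + s ≤ i → g i = 0) :
    ∑ i ∈ Finset.range n, g i = ∑ j ∈ Finset.range s, g (α + j) := by
  rw [show ∑ j ∈ Finset.range s, g (α + j) = ∑ i ∈ Finset.Ico α (α + s), g i by
    rw [Finset.sum_Ico_eq_sum_range, Nat.add_sub_cancel_left]]
  refine (Finset.sum_subset (fun i hi => ?_) fun i hi' hi =>
    h i (Finset.mem_range.1 hi') ?_).symm
  · simp only [Finset.mem_Ico, Finset.mem_range] at *; omega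
  · simp only [Finset.mem_Ico] at hi; omega

open Classical in
lemma UpDownLabel.descendants_succ {m f d M : ℕ} {L : List ℕ} (h : UpDownLabel m L f d M)
    (k : ℕ) :
    descendants UpDownAvoid (k + 1) L = ∑ y ∈ Finset.range (m + 1),
      if f ≤ y ∧ y < M then ∑ x ∈ Finset.range (y + 1),
        descendants UpDownAvoid k (insertFirst x (insertFirst y L)) else 0 := by
  rw [descendants, length_of_mem_permWords h.mem]
  refine Finset.sum_congr rfl fun y hy => ?_
  rw [Finset.mem_range] at hy
  split_ifs with hy'
  · rw [sum_range_eq_of_support (α := 0) (s := y + 1) (by omega)]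
    · refine Finset.sum_congr rfl fun x hx => ?_
      rw [Finset.mem_range] at hx
      rw [if_pos ((h.avoid_iff (by omega) (by omega)).2 (by omega)), zero_add]
    · intro x hxm hx
      refine if_neg fun h' => ?_
      have := (h.avoid_iff (by omega) (by omega)).1 h'
      omega
  · refine Finset.sum_eq_zero fun x hx => if_neg fun h' => ?_
    rw [Finset.mem_range] at hx
    have := (h.avoid_iff (by omega) (by omega)).1 h'
    omega

lemma UpDownLabel.descendants_eq_zero {m f d M : ℕ} {L : List ℕ} (h : UpDownLabel m L f d M)
    (hfM : M ≤ f) (k : ℕ) : descendants UpDownAvoid (k + 1) L = 0 := by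
  rw [h.descendants_succ]
  exact Finset.sum_eq_zero fun y _ => if_neg (by omega)

lemma UpDownLabel.descendants_eq {m α s : ℕ} {L : List ℕ}
    (h : UpDownLabel m L α (α + 1) (α + s)) (hs : 1 ≤ s) (hm : α + s ≤ m + 1) (k : ℕ) :
    descendants UpDownAvoid (k + 1) L = shiftedCount k α s := by
  induction k generalizing m α s L with
  | zero =>
    rw [h.descendants_succ, shiftedCount_zero, sum_range_eq_of_support hm]
    · refine Finset.sum_congr rfl fun j hj => ?_
      rw [Finset.mem_range] at hj
      rw [if_pos (by omega)]
      simp [descendants]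
    · exact fun y _ hy => if_neg (by omega)
  | succ k ih =>
    have child : ∀ j < s, ∑ x ∈ Finset.range (α + j + 1),
        descendants UpDownAvoid (k + 1) (insertFirst x (insertFirst (α + j) L)) =
        ∑ u ∈ Finset.range (α + 1),
          shiftedCount k (u + 1) (α + 2 + (if j = 0 then s - 1 else j - 1) - u) := by
      intro j hj
      rw [sum_range_eq_of_support (α := 0) (s := α + 1) (n := α + j + 1) (by omega)]
      · refine Finset.sum_congr rfl fun x hx => ?_
        rw [Finset.mem_range] at hx
        have hc := h.insert (x := 0 + x) (y := α + j) (by omega) (by omega) (by omega) (by omega)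
        rw [if_pos (by omega), if_pos (by omega)] at hc
        have e : (if α + 1 ≤ α + j then α + j + 2 else α + s + 2) = x + 1 +
            (α + 2 + (if j = 0 then s - 1 else j - 1) - x) := by split_ifs <;> omega
        rw [e, zero_add] at hc
        rw [zero_add]
        exact ih hc (by omega) (by split_ifs at e ⊢ <;> omega)
      -- Here `x ≥ α + 1`, so the child's 312 threshold equals its least admissible height and the
      -- child is dead.
      · intro x hxj hx
        have hc := h.insert (x := x) (y := α + j) (by omega) (by omega) (by omega) (by omega)
        rw [if_neg (by omega), if_neg (by omega)] at hc
        exact hc.descendants_eq_zero le_rfl k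
    rw [h.descendants_succ, shiftedCount_succ, sum_range_eq_of_support hm]
    · obtain ⟨s, rfl⟩ := Nat.exists_eq_add_of_le' hs
      -- The children are matched by a cyclic shift: `y = α` keeps the old 312 threshold and
      -- supplies the last summand; every other `j` supplies summand `j - 1`.
      rw [Finset.sum_range_succ' _ s, Finset.sum_range_succ _ s]
      congr 1
      · refine Finset.sum_congr rfl fun j hj => ?_
        rw [Finset.mem_range] at hj
        rw [if_pos (by omega), child _ (by omega)]
        simp
      · rw [if_pos (by omega), child 0 (by omega)]
        simp
    · exact fun y _ hy => if_neg (by omega)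

lemma descendants_upDownAvoid_nil (n : ℕ) :
    descendants UpDownAvoid n [] = tabCount n n n := by
  cases n with
  | zero => simp [descendants, tabCount]
  | succ k =>
    -- A threshold of `m + 1`, here 1, encodes that the pattern does not occur.
    have h : UpDownLabel 0 [] 0 (0 + 1) (0 + 1) :=
      ⟨by simp [permWords], by simp [UpDownAvoid, zigzag, hasTopThen], by simp, by simp [asc],
        by simp [topThen]⟩
    rw [h.descendants_eq le_rfl (by omega), shiftedCount]
    exact psum_markedCount_self_eq k

open Classical in
lemma DownUpLabel.descendants_succ {m a b : ℕ} {L : List ℕ} (h : DownUpLabel m L a b)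
    (hab : a ≤ b) (hb : b ≤ m + 1) (k : ℕ) :
    descendants DownUpAvoid (k + 1) L = ∑ y ∈ Finset.range a, ∑ r ∈ Finset.range (b - y),
        descendants DownUpAvoid k (insertFirst (y + 1 + r) (insertFirst y L)) := by
  rw [descendants, length_of_mem_permWords h.mem,
    sum_range_eq_of_support (α := 0) (s := a) (by omega)]
  · refine Finset.sum_congr rfl fun y hy => ?_
    rw [Finset.mem_range] at hy
    rw [zero_add, sum_range_eq_of_support (α := y + 1) (s := b - y) (by omega)]
    · refine Finset.sum_congr rfl fun r hr => ?_
      rw [Finset.mem_range] at hr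
      exact if_pos ((h.avoid_iff hab (by omega) (by omega)).2 (by omega))
    · intro x hxm hx
      refine if_neg fun h' => ?_
      have := (h.avoid_iff hab (by omega) (by omega)).1 h'
      omega
  · intro y hym hy
    refine Finset.sum_eq_zero fun x hx => if_neg fun h' => ?_
    rw [Finset.mem_range] at hx
    have := (h.avoid_iff hab (by omega) (by omega)).1 h'
    omega

/-- The children tile the rectangle rule for `(a, b)`: `y > 0` gives the labels with first entry at
most `a` and second at most `b + 1`; `y = 0` gives second entry `b + 2` when `x ≤ a`, and first
entry `a + 1` with second at most `b + 1` when `x > a`. -/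
lemma DownUpLabel.descendants_eq {m α s : ℕ} {L : List ℕ}
    (h : DownUpLabel m L (α + 1) (α + 1 + s)) (hm : α + 1 + s ≤ m + 1) (k : ℕ) :
    descendants DownUpAvoid k L = rectCount k α s := by
  induction k generalizing m α s L with
  | zero => rw [rectCount_zero, descendants]
  | succ k ih =>
    have child : ∀ y r, y < α + 1 → r < α + 1 + s - y →
        descendants DownUpAvoid k (insertFirst (y + 1 + r) (insertFirst y L)) =
          if 0 < y then rectCount k y (r + 1) else
          if r < α + 1 then rectCount k (r + 1) (α + s + 1 - r) else
            rectCount k (α + 1) (r - α) := by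
      intro y r hy hr
      have hc := h.insert (x := y + 1 + r) (y := y) (by omega) (by omega) (by omega) (by omega)
        (by omega) (by omega)
      split_ifs with h1 h2
      · rw [if_pos h1, if_pos h1, show y + 1 + r + 1 = y + 1 + (r + 1) by ring] at hc
        exact ih hc (by omega)
      · rw [if_neg h1, if_neg h1, if_pos (by omega),
          show min (y + 1 + r + 1) (α + 1 + 1) = r + 1 + 1 by omega,
          show α + 1 + s + 2 = r + 1 + 1 + (α + s + 1 - r) by omega] at hc
        exact ih hc (by omega)
      · rw [if_neg h1, if_neg h1, if_neg (by omega),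
          show min (y + 1 + r + 1) (α + 1 + 1) = α + 1 + 1 by omega,
          show y + 1 + r + 1 = α + 1 + 1 + (r - α) by omega] at hc
        exact ih hc (by omega)
    have h0 : ∑ r ∈ Finset.range (α + 1 + s),
        descendants DownUpAvoid k (insertFirst (0 + 1 + r) (insertFirst 0 L)) =
        ∑ u ∈ Finset.range (α + 1), rectCount k (u + 1) (α + s + 1 - u) +
          ∑ r ∈ Finset.range s, rectCount k (α + 1) (r + 1) := by
      rw [Finset.sum_range_add]
      congr 1
      · refine Finset.sum_congr rfl fun r hr => ?_
        rw [Finset.mem_range] at hr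
        rw [child 0 r (by omega) (by omega), if_neg (by omega), if_pos hr]
      · refine Finset.sum_congr rfl fun r hr => ?_
        rw [Finset.mem_range] at hr
        rw [child 0 _ (by omega) (by omega), if_neg (by omega), if_neg (by omega),
          show α + 1 + r - α = r + 1 by omega]
    have h1 : ∀ y ∈ Finset.range α, ∑ r ∈ Finset.range (α + 1 + s - (y + 1)),
        descendants DownUpAvoid k (insertFirst (y + 1 + 1 + r) (insertFirst (y + 1) L)) =
        ∑ r ∈ Finset.range (α + s - y), rectCount k (y + 1) (r + 1) := by
      intro y hy
      rw [Finset.mem_range] at hy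
      rw [show α + 1 + s - (y + 1) = α + s - y by omega]
      refine Finset.sum_congr rfl fun r hr => ?_
      rw [Finset.mem_range] at hr
      rw [child _ _ (by omega) (by omega), if_pos (by omega)]
    -- The term split off has second entry `b + 2`, the edge filled by `y = 0`, `x ≤ a`.
    have h2 : ∀ u ∈ Finset.range (α + 1), ∑ r ∈ Finset.range (α + s + 1 - u),
        rectCount k (u + 1) (r + 1) = ∑ r ∈ Finset.range (α + s - u), rectCount k (u + 1) (r + 1) +
          rectCount k (u + 1) (α + s + 1 - u) := by
      intro u hu
      rw [Finset.mem_range] at hu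
      rw [show α + s + 1 - u = α + s - u + 1 by omega, Finset.sum_range_succ]
    rw [h.descendants_succ (by omega) hm, Finset.sum_range_succ' _ α, Finset.sum_congr rfl h1,
      Nat.sub_zero, h0, rectCount_succ, Finset.sum_congr rfl h2, Finset.sum_add_distrib,
      Finset.sum_range_succ (fun u => ∑ r ∈ Finset.range (α + s - u), _) α,
      show α + s - α = s by omega]
    ring

lemma descendants_downUpAvoid_nil (n : ℕ) :
    descendants DownUpAvoid n [] = tabCount n n n := by
  have h : DownUpLabel 0 [] (0 + 1) (0 + 1 + 0) :=
    ⟨by simp [permWords], by simp [DownUpAvoid, zigzag, hasTopThen], by simp, by simp [topThen],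
      by simp [topThen]⟩
  rw [h.descendants_eq le_rfl, rectCount]
  rfl

/-! ### From permutations to words -/

/-- Abstracting the shape into `R` lets the characterization be nested, one letter of the pattern at
a time. -/
lemma topThen_iff_sublist {Q R : List ℕ → ℕ → Prop}
    (hQ : ∀ L t, Q L t ↔ ∃ l, l.Sublist L ∧ R l t) (L : List ℕ) (t : ℕ) :
    topThen Q L t ↔ ∃ l, l.Sublist L ∧ ∃ c l', l = c :: l' ∧ c < t ∧ R l' c := by
  induction L with
  | nil => simp [topThen]
  | cons x L ih =>
    rw [topThen, ih, hQ]
    constructor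
    · rintro (⟨_, h1, h2⟩ | ⟨hx, l, h1, h2⟩)
      · exact ⟨_, h1.cons x, h2⟩
      · exact ⟨_, h1.cons_cons x, x, l, rfl, hx, h2⟩
    · rintro ⟨_, h, c, l', rfl, hc, h2⟩
      rcases List.cons_sublist_cons'.1 h with h' | ⟨rfl, h'⟩
      · exact Or.inl ⟨_, h', c, l', rfl, hc, h2⟩
      · exact Or.inr ⟨hc, l', h', h2⟩

lemma hasTopThen_iff_sublist {Q R : List ℕ → ℕ → Prop}
    (hQ : ∀ L t, Q L t ↔ ∃ l, l.Sublist L ∧ R l t) (L : List ℕ) :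
    hasTopThen Q L ↔ ∃ l, l.Sublist L ∧ ∃ c l', l = c :: l' ∧ R l' c := by
  induction L with
  | nil => simp [hasTopThen]
  | cons x L ih =>
    rw [hasTopThen, ih, hQ]
    constructor
    · rintro (⟨_, h1, h2⟩ | ⟨l, h1, h2⟩)
      · exact ⟨_, h1.cons x, h2⟩
      · exact ⟨_, h1.cons_cons x, x, l, rfl, h2⟩
    · rintro ⟨_, h, c, l', rfl, h2⟩
      rcases List.cons_sublist_cons'.1 h with h' | ⟨rfl, h'⟩
      · exact Or.inl ⟨_, h', c, l', rfl, h2⟩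
      · exact Or.inr ⟨l', h', h2⟩

lemma hasBelow_iff_sublist (L : List ℕ) (t : ℕ) :
    hasBelow L t ↔ ∃ l, l.Sublist L ∧ ∃ a, l = [a] ∧ a < t := by
  constructor
  · rintro ⟨a, h, ha⟩
    exact ⟨_, List.singleton_sublist.2 h, a, rfl, ha⟩
  · rintro ⟨_, h, a, rfl, ha⟩
    exact ⟨a, List.singleton_sublist.1 h, ha⟩

lemma asc_iff_sublist (L : List ℕ) (t : ℕ) :
    asc L t ↔ ∃ l, l.Sublist L ∧ ∃ a b, l = [a, b] ∧ a < b ∧ b < t := by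
  induction L with
  | nil => simp [asc]
  | cons x L ih =>
    rw [asc, ih]
    constructor
    · rintro (⟨_, h1, h2⟩ | ⟨b, hb, h1, h2⟩)
      · exact ⟨_, h1.cons x, h2⟩
      · exact ⟨_, (List.singleton_sublist.2 hb).cons_cons x, x, b, rfl, h1, h2⟩
    · rintro ⟨_, h, a, b, rfl, h1, h2⟩
      rcases List.cons_sublist_cons'.1 h with h' | ⟨rfl, h'⟩
      · exact Or.inl ⟨_, h', a, b, rfl, h1, h2⟩
      · exact Or.inr ⟨b, List.singleton_sublist.1 h', h1, h2⟩

lemma ofFn_sublist_ofFn_iff {m k : ℕ} (v : Fin k → ℕ) (w : Fin m → ℕ) :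
    (List.ofFn v).Sublist (List.ofFn w) ↔ ∃ f : Fin k → Fin m, StrictMono f ∧ v = w ∘ f := by
  rw [List.sublist_iff_exists_fin_orderEmbedding_get_eq]
  constructor
  · rintro ⟨e, he⟩
    refine ⟨fun i => Fin.cast (List.length_ofFn) (e (Fin.cast (List.length_ofFn).symm i)),
      fun i j hij => ?_, ?_⟩
    · have : e (Fin.cast (List.length_ofFn).symm i) < e (Fin.cast (List.length_ofFn).symm j) :=
        e.strictMono hij
      exact this
    · funext i
      have := he (Fin.cast (List.length_ofFn).symm i)
      rw [List.get_ofFn, List.get_ofFn] at this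
      exact this
  · rintro ⟨f, hf, rfl⟩
    refine ⟨OrderEmbedding.ofStrictMono (fun i => Fin.cast (List.length_ofFn).symm
      (f (Fin.cast (List.length_ofFn) i))) fun i j hij => ?_, fun i => ?_⟩
    · exact hf (show Fin.cast _ i < Fin.cast _ j from hij)
    · rw [List.get_ofFn, List.get_ofFn]
      rfl

lemma exists_sublist_four_iff {m : ℕ} (w : Fin m → ℕ) (P : ℕ → ℕ → ℕ → ℕ → Prop) :
    (∃ a b c d, [a, b, c, d].Sublist (List.ofFn w) ∧ P a b c d) ↔
      ∃ f : Fin 4 → Fin m, StrictMono f ∧ P (w (f 0)) (w (f 1)) (w (f 2)) (w (f 3)) := by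
  constructor
  · rintro ⟨a, b, c, d, h, hP⟩
    have h' : (List.ofFn ![a, b, c, d]).Sublist (List.ofFn w) := by simpa using h
    obtain ⟨f, hf, hv⟩ := (ofFn_sublist_ofFn_iff _ _).1 h'
    refine ⟨f, hf, ?_⟩
    have h0 := congrFun hv 0
    have h1 := congrFun hv 1
    have h2 := congrFun hv 2
    have h3 := congrFun hv 3
    simp only [Function.comp] at h0 h1 h2 h3
    rw [← h0, ← h1, ← h2, ← h3]
    exact hP
  · rintro ⟨f, hf, hP⟩
    refine ⟨_, _, _, _, ?_, hP⟩
    have h := (ofFn_sublist_ofFn_iff (w ∘ f) w).2 ⟨f, hf, rfl⟩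
    simpa [List.ofFn_succ] using h

lemma hasTopThen_topThen_asc_iff (L : List ℕ) : hasTopThen (topThen asc) L ↔
    ∃ a b c d, [a, b, c, d].Sublist L ∧ c < d ∧ d < b ∧ b < a := by
  rw [hasTopThen_iff_sublist (topThen_iff_sublist asc_iff_sublist)]
  constructor
  · rintro ⟨_, h, a, _, rfl, b, _, rfl, h1, c, d, rfl, h2, h3⟩
    exact ⟨a, b, c, d, h, h2, h3, h1⟩
  · rintro ⟨a, b, c, d, h, h1, h2, h3⟩
    exact ⟨_, h, a, _, rfl, b, _, rfl, h3, c, d, rfl, h1, h2⟩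

lemma hasTopThen_topThen_topThen_iff (L : List ℕ) :
    hasTopThen (topThen (topThen hasBelow)) L ↔
      ∃ a b c d, [a, b, c, d].Sublist L ∧ d < c ∧ c < b ∧ b < a := by
  rw [hasTopThen_iff_sublist (topThen_iff_sublist (topThen_iff_sublist hasBelow_iff_sublist))]
  constructor
  · rintro ⟨_, h, a, _, rfl, b, _, rfl, h1, c, _, rfl, h2, d, rfl, h3⟩
    exact ⟨a, b, c, d, h, h3, h2, h1⟩
  · rintro ⟨a, b, c, d, h, h1, h2, h3⟩
    exact ⟨_, h, a, _, rfl, b, _, rfl, h3, c, _, rfl, h2, d, rfl, h1⟩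

lemma contains_pattern4312_iff {m : ℕ} (π : Equiv.Perm (Fin m)) :
    Contains π pattern4312 ↔ hasTopThen (topThen asc) (List.ofFn fun i => (π i : ℕ)) := by
  rw [hasTopThen_topThen_asc_iff,
    exists_sublist_four_iff _ fun a b c d => c < d ∧ d < b ∧ b < a]
  refine exists_congr fun f => and_congr_right fun _ => ⟨fun h => ?_, fun h a b => ?_⟩
  · exact ⟨(h 2 3).2 (by decide), (h 3 1).2 (by decide), (h 1 0).2 (by decide)⟩
  · rw [Fin.lt_def]
    fin_cases a <;> fin_cases b <;> simp [pattern4312] <;> omega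

lemma contains_pattern1234_iff {m : ℕ} (π : Equiv.Perm (Fin m)) :
    Contains π pattern1234 ↔
      hasTopThen (topThen (topThen hasBelow)) (List.ofFn fun i => ((π i).rev : ℕ)) := by
  rw [hasTopThen_topThen_topThen_iff,
    exists_sublist_four_iff _ fun a b c d => d < c ∧ c < b ∧ b < a]
  refine exists_congr fun f => and_congr_right fun _ => ?_
  simp only [Fin.val_fin_lt, Fin.rev_lt_rev]
  refine ⟨fun h => ?_, fun h a b => ?_⟩
  · exact ⟨(h 2 3).2 (by decide), (h 1 2).2 (by decide), (h 0 1).2 (by decide)⟩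
  · simp only [Fin.lt_def] at h ⊢
    fin_cases a <;> fin_cases b <;> simp [pattern1234] <;> omega

lemma upDownAvoid_ofFn_iff {m : ℕ} (π : Equiv.Perm (Fin m)) :
    UpDownAvoid (List.ofFn fun i => (π i : ℕ)) ↔ π ∈ avoidingAlternating m pattern4312 := by
  rw [UpDownAvoid, ← contains_pattern4312_iff, zigzag_iff_getElem]
  simp [avoidingAlternating, IsAlternating]

lemma downUpAvoid_ofFn_iff {m : ℕ} (π : Equiv.Perm (Fin m)) :
    DownUpAvoid (List.ofFn fun i => ((π i).rev : ℕ)) ↔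
      π ∈ avoidingAlternating m pattern1234 := by
  rw [DownUpAvoid, ← contains_pattern1234_iff, zigzag_iff_getElem]
  simp only [List.getElem_ofFn, List.length_ofFn, gt_iff_lt, Fin.val_fin_lt, Fin.rev_lt_rev]
  rfl

lemma ofFn_mem_permWords {m : ℕ} (π : Equiv.Perm (Fin m)) :
    (List.ofFn fun i => (π i : ℕ)) ∈ permWords m := by
  refine mem_permWords_iff.2 ⟨List.nodup_ofFn.2 fun i j h => π.injective (Fin.ext h), fun v => ?_⟩
  rw [List.mem_ofFn]
  constructor
  · rintro ⟨i, rfl⟩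
    exact (π i).2
  · exact fun h => ⟨π.symm ⟨v, h⟩, by simp⟩

lemma exists_ofFn_eq_of_mem_permWords {m : ℕ} {L : List ℕ} (hL : L ∈ permWords m) :
    ∃ π : Equiv.Perm (Fin m), (List.ofFn fun i => (π i : ℕ)) = L := by
  obtain ⟨hn, hm⟩ := mem_permWords_iff.1 hL
  obtain rfl := length_of_mem_permWords hL
  let g : Fin L.length → Fin L.length := fun i => ⟨L.get i, (hm _).1 (L.get_mem i)⟩
  have hg : Function.Injective g := fun i j h =>
    List.nodup_iff_injective_get.1 hn (congrArg Fin.val h)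
  refine ⟨Equiv.ofBijective g (Finite.injective_iff_bijective.1 hg), ?_⟩
  exact List.ofFn_get L

open Classical in
-- The relabelling `e` serves both patterns: the identity for 4312 and the complement for 1234.
lemma ncard_eq_card_filter {m : ℕ} {V : List ℕ → Prop} {A : Set (Equiv.Perm (Fin m))}
    (e : Equiv.Perm (Fin m))
    (h : ∀ π : Equiv.Perm (Fin m), V (List.ofFn fun i => (e (π i) : ℕ)) ↔ π ∈ A) :
    A.ncard = ((permWords m).filter V).card := by
  have hinj : Function.Injective fun π : Equiv.Perm (Fin m) =>
      List.ofFn fun i => (e (π i) : ℕ) := fun π ρ hπ =>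
    Equiv.ext fun i => e.injective (Fin.ext (congrFun (List.ofFn_injective hπ) i))
  rw [← Set.ncard_image_of_injective A hinj, ← Set.ncard_coe_finset]
  congr 1
  ext L
  simp only [Set.mem_image, Finset.coe_filter, Set.mem_ofPred_eq]
  constructor
  · rintro ⟨π, hπ, rfl⟩
    exact ⟨ofFn_mem_permWords (π.trans e), (h π).2 hπ⟩
  · rintro ⟨hL, hV⟩
    obtain ⟨π, rfl⟩ := exists_ofFn_eq_of_mem_permWords hL
    refine ⟨π.trans e.symm, (h _).1 ?_, ?_⟩ <;> simp [hV]

theorem ncard_avoidingAlternating_pattern4312 (n : ℕ) :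
    ((avoidingAlternating (2 * n) pattern4312).ncard : ℚ) = tabCount n n n := by
  rw [ncard_eq_card_filter 1 upDownAvoid_ofFn_iff, card_filter_permWords,
    descendants_upDownAvoid_nil]
  · simp [UpDownAvoid, zigzag, hasTopThen]
  · exact fun x y L h => ((upDownAvoid_insertFirst x y L).1 h).1

theorem ncard_avoidingAlternating_pattern1234 (n : ℕ) :
    ((avoidingAlternating (2 * n) pattern1234).ncard : ℚ) = tabCount n n n := by
  rw [ncard_eq_card_filter Fin.revPerm downUpAvoid_ofFn_iff, card_filter_permWords,
    descendants_downUpAvoid_nil]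
  · simp [DownUpAvoid, zigzag, hasTopThen]
  · exact fun x y L h => ((downUpAvoid_insertFirst x y L).1 h).1

end AltPerm

theorem theorem3p2 (n : ℕ) (hn : 1 ≤ n) :
    (AltPerm.avoidingAlternating (2 * n) AltPerm.pattern4312).ncard =
      (AltPerm.avoidingAlternating (2 * n) AltPerm.pattern1234).ncard ∧
    ((AltPerm.avoidingAlternating (2 * n) AltPerm.pattern4312).ncard : ℚ) =
      2 * ((3 * n)! : ℚ) / ((n ! : ℚ) * ((n + 1)! : ℚ) * ((n + 2)! : ℚ)) ∧
    ((AltPerm.avoidingAlternating (2 * n) AltPerm.pattern1234).ncard : ℚ) =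
      2 * ((3 * n)! : ℚ) / ((n ! : ℚ) * ((n + 1)! : ℚ) * ((n + 2)! : ℚ)) := by
  have h1 := AltPerm.ncard_avoidingAlternating_pattern4312 n
  have h2 := AltPerm.ncard_avoidingAlternating_pattern1234 n
  refine ⟨by exact_mod_cast h1.trans h2.symm, ?_, ?_⟩
  · rw [h1, AltPerm.tabCount_self]
  · rw [h2, AltPerm.tabCount_self]
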